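/- Let $G$ be a compact Lie group with normalised Haar measure $\mu_G$, acting continuously and transitively on a Hausdorff space $X$. Fix a base point $x_0\in X$, and let $H=\{h\in G: h\cdot x_0=x_0\}$ be its stabiliser, with normalised Haar measure $\mu_H$. For $f:X\to\mathbb C$ let $\tilde f(g)=f(g\cdot x_0)$ be its lift to $G$, and equip $X$ with the measure $dx$ determined by $\int_X f(x)\,dx=\int_G\tilde f(g)\,d\mu_G(g)$. For $F:G\to\mathbb C$ put $\check F(g)=\overline{F(g^{-1})}$. Let $\widehat G$ be the set of equivalence classes of irreducible unitary representations of $G$, and fix for each class a representative, a continuous homomorphism $\pi:G\to \mathrm U(d_\pi)$. For $\phi\in L^1(X)$ put $$\hat\phi(\pi)=\int_G\tilde\phi(g)\,\pi(g)^*\,d\mu_G(g),\qquad \hat H(\pi)=\int_H\pi(h)\,d\mu_H(h).$$ A function $\phi$ on $X$ is called zonal (with respect to $x_0$) if for every $h\in H$ one has $\phi(h\cdot x)=\phi(x)$ for almost every $x\in X$. Then for every $\phi\in L^1(X)$ the following are equivalent: 1. $\phi$ is zonal; 2. $\hat H(\pi)\hat\phi(\pi)=\hat\phi(\pi)\hat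 H(\pi)$ for all $\pi\in\widehat G$; 3. there is a function $\check\phi\in L^1(X)$ with $\check{\tilde\phi}=\tilde{\check\phi}$ almost everywhere on $G$. If moreover $\phi\in L^2(X)$, these are also equivalent to the existence of a function $\check\phi\in L^2(X)$ with $\check{\tilde\phi}=\tilde{\check\phi}$ almost everywhere on $G$. -/

import Mathlib

open MeasureTheory
open scoped ContDiff Manifold ComplexConjugate

namespace ZonalFourier

section Representations

variable (G : Type*) [Group G] [TopologicalSpace G]

/-- An irreducible unitary representation of `G`: a continuous homomorphism `π : G → U(d)`, `d ≥ 1`,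
whose commutant consists of the scalar matrices only. -/
structure IrrUnitaryRep where
  dim : ℕ
  dim_pos : 0 < dim
  hom : G →* Matrix.unitaryGroup (Fin dim) ℂ
  continuous_hom : Continuous hom
  irreducible : ∀ A : Matrix (Fin dim) (Fin dim) ℂ,
    (∀ g, (hom g : Matrix (Fin dim) (Fin dim) ℂ) * A = A * (hom g : Matrix (Fin dim) (Fin dim) ℂ)) →
      ∃ c : ℂ, A = c • (1 : Matrix (Fin dim) (Fin dim) ℂ)

variable {G}

/-- The unitary matrix `π(g)`. -/
def IrrUnitaryRep.mat (π : IrrUnitaryRep G) (g : G) : Matrix (Fin π.dim) (Fin π.dim) ℂ :=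
  (π.hom g : Matrix (Fin π.dim) (Fin π.dim) ℂ)

/-- Equivalence of representations: `π₁(g) A = A π₂(g)` for all `g`, for some invertible `A`
(with inverse `B`). -/
def IrrUnitaryRep.Equivalent (π₁ π₂ : IrrUnitaryRep G) : Prop :=
  ∃ (A : Matrix (Fin π₁.dim) (Fin π₂.dim) ℂ) (B : Matrix (Fin π₂.dim) (Fin π₁.dim) ℂ),
    A * B = 1 ∧ B * A = 1 ∧ ∀ g, π₁.mat g * A = A * π₂.mat g

theorem IrrUnitaryRep.equivalent_equivalence :
    Equivalence (IrrUnitaryRep.Equivalent (G := G)) where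
  refl π := ⟨1, 1, by simp, by simp, by simp⟩
  symm := by
    rintro π₁ π₂ ⟨A, B, hAB, hBA, h⟩
    refine ⟨B, A, hBA, hAB, fun g => ?_⟩
    calc π₂.mat g * B = B * A * π₂.mat g * B := by rw [hBA, Matrix.one_mul]
      _ = B * (π₁.mat g * A) * B := by rw [h g, Matrix.mul_assoc B A]
      _ = B * π₁.mat g := by
        rw [Matrix.mul_assoc B, Matrix.mul_assoc (π₁.mat g), hAB, Matrix.mul_one]
  trans := by
    rintro π₁ π₂ π₃ ⟨A, B, hAB, hBA, h⟩ ⟨C, D, hCD, hDC, k⟩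
    refine ⟨A * C, D * B, ?_, ?_, fun g => ?_⟩
    · rw [Matrix.mul_assoc, ← Matrix.mul_assoc C, hCD, Matrix.one_mul, hAB]
    · rw [Matrix.mul_assoc, ← Matrix.mul_assoc B, hBA, Matrix.one_mul, hDC]
    · rw [← Matrix.mul_assoc, h g, Matrix.mul_assoc, k g, Matrix.mul_assoc]

variable (G)

/-- Equivalence of irreducible unitary representations as a setoid. -/
def irrSetoid : Setoid (IrrUnitaryRep G) :=
  ⟨IrrUnitaryRep.Equivalent, IrrUnitaryRep.equivalent_equivalence⟩

/-- The dual `Ĝ`: the set of equivalence classes of irreducible unitary representations. -/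
def Dual : Type _ := Quotient (irrSetoid G)

variable {G}

/-- The class in `Ĝ` of an irreducible unitary representation. -/
def IrrUnitaryRep.toDual (π : IrrUnitaryRep G) : Dual G := Quotient.mk (irrSetoid G) π

end Representations

noncomputable section

section HaarMeasure

variable (G : Type*) [Group G] [TopologicalSpace G] [IsTopologicalGroup G] [CompactSpace G]
  [MeasurableSpace G] [BorelSpace G]

/-- The Haar measure of total mass one on a compact group. -/
def normHaar : Measure G := Measure.haarMeasure (⊤ : TopologicalSpace.PositiveCompacts G)

variable {G}

/-- The Fourier coefficient `f̂(π) = ∫ f(g) π(g)* dμ_G(g)`, with the matrix-valued integral taken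
entry by entry. -/
def groupFourierCoeff (f : G → ℂ) (π : IrrUnitaryRep G) : Matrix (Fin π.dim) (Fin π.dim) ℂ :=
  Matrix.of fun i j => ∫ g, f g * (π.mat g).conjTranspose i j ∂(normHaar G)

end HaarMeasure

section HomogeneousSpace

variable {G : Type*} [Group G] [TopologicalSpace G] [IsTopologicalGroup G] [CompactSpace G]
  [MeasurableSpace G] [BorelSpace G]
  {X : Type*} [TopologicalSpace X] [T2Space X] [MulAction G X] [ContinuousSMul G X]

instance compactSpace_stabilizer (x₀ : X) : CompactSpace (MulAction.stabilizer G x₀) := by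
  have h : IsClosed ((MulAction.stabilizer G x₀ : Subgroup G) : Set G) := by
    have : ((MulAction.stabilizer G x₀ : Subgroup G) : Set G) = {g : G | g • x₀ = x₀} := by
      ext g; simp [MulAction.mem_stabilizer_iff]
    rw [this]
    exact isClosed_eq (by fun_prop) continuous_const
  exact isCompact_iff_compactSpace.mp h.isCompact

/-- The matrix `Ĥ(π) = ∫_H π(h) dμ_H(h)`, where `H` is the stabiliser of `x₀` with its normalised
Haar measure; the integral is taken entry by entry. -/
def stabCoeff (x₀ : X) (π : IrrUnitaryRep G) : Matrix (Fin π.dim) (Fin π.dim) ℂ :=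
  Matrix.of fun i j =>
    ∫ h : MulAction.stabilizer G x₀, π.mat (h : G) i j ∂(normHaar (MulAction.stabilizer G x₀))

/-- The lift `f̃(g) = f(g • x₀)` to `G` of a function `f` on `X`. -/
def lift (G : Type*) [Group G] {X : Type*} [MulAction G X] (x₀ : X) (f : X → ℂ) : G → ℂ :=
  fun g => f (g • x₀)

/-- The involution `f ↦ (g ↦ conj (f (g⁻¹)))` of functions on `G`. -/
def involution {G : Type*} [Group G] (f : G → ℂ) : G → ℂ := fun g => conj (f g⁻¹)

/-- The `G`-invariant measure `dx` on `X`, determined by `∫ f(x) dx = ∫ f(g • x₀) dμ_G(g)`. -/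
def homMeasure (G : Type*) [Group G] [TopologicalSpace G] [IsTopologicalGroup G] [CompactSpace G]
    [MeasurableSpace G] [BorelSpace G] {X : Type*} [MulAction G X] [MeasurableSpace X] (x₀ : X) :
    Measure X :=
  (normHaar G).map (fun g : G => g • x₀)

/-- `f` is zonal with respect to `x₀`: it is invariant under the action of the stabiliser of `x₀`,
where functions that agree almost everywhere are identified. -/
def IsZonal (G : Type*) [Group G] [TopologicalSpace G] [IsTopologicalGroup G] [CompactSpace G]
    [MeasurableSpace G] [BorelSpace G] {X : Type*} [MulAction G X] [MeasurableSpace X] (x₀ : X)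
    (f : X → ℂ) : Prop :=
  ∀ h ∈ MulAction.stabilizer G x₀, (fun x => f (h • x)) =ᵐ[homMeasure G x₀] f

end HomogeneousSpace

end

end ZonalFourier

/-! Let F be the lift of φ. It is right H-invariant at every point, so Ĥ(π)F̂(π) = F̂(π) always, and
commutation says exactly F̂(π)Ĥ(π) = F̂(π). Replacing F by its left translate by h multiplies F̂(π)
on the right by π(h), and Ĥ(π)π(h) = Ĥ(π) for h in H. So commutation for all π means that F and its
left H-translates have the same Fourier coefficients. By uniqueness of Fourier coefficients in L¹(G)
(`ae_eq_zero_of_groupFourierCoeff_eq_zero`) this is left H-invariance of F almost everywhere, which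
is zonality (`isZonal_iff_lift`).

The involution exchanges left and right translations, so φ is zonal iff the involution of F is right
H-invariant almost everywhere. Such a function descends to X by averaging over H
(`exists_memLp_lift_ae_eq`).

Uniqueness is proved in Peter–Weyl style. Compact self-adjoint operators commuting with right
translations show that finite-dimensional stable subspaces span a dense part of L²(G)
(`finiteVectors_orthogonal`). A convolution argument then carries this from L² to L¹
(`integral_conj_mul_eq_zero_of_groupFourierCoeff`). -/

namespace ZonalFourier

/-! ### Stable subspaces and irreducible matrix representations -/

section UnitaryRepresentations

variable {G : Type*} [Group G]
  {V : Type*} [NormedAddCommGroup V] [InnerProductSpace ℂ V]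

/-- A subspace stable under an isometric representation. -/
def IsStable (ρ : G →* (V →ₗᵢ[ℂ] V)) (U : Submodule ℂ V) : Prop :=
  ∀ g, ∀ u ∈ U, ρ g u ∈ U

theorem inner_rep_left (ρ : G →* (V →ₗᵢ[ℂ] V)) (g : G) (u v : V) :
    inner ℂ (ρ g u) v = inner ℂ u (ρ g⁻¹ v) := by
  rw [← (ρ g).inner_map_map u (ρ g⁻¹ v), ← Function.comp_apply (f := ρ g) (g := ρ g⁻¹),
    ← LinearIsometry.coe_mul, ← map_mul]
  simp

theorem IsStable.orthogonal {ρ : G →* (V →ₗᵢ[ℂ] V)} {U : Submodule ℂ V} (hU : IsStable ρ U) :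
    IsStable ρ Uᗮ := by
  intro g u hu v hv
  rw [← inv_inv g, ← inner_rep_left]
  exact hu _ (hU _ _ hv)

theorem IsStable.inf {ρ : G →* (V →ₗᵢ[ℂ] V)} {U W : Submodule ℂ V} (hU : IsStable ρ U)
    (hW : IsStable ρ W) : IsStable ρ (U ⊓ W) :=
  fun g u hu => ⟨hU g u hu.1, hW g u hu.2⟩

variable [TopologicalSpace G]

/-- A nonzero finite-dimensional stable subspace without proper nonzero stable subspaces is given,
in an orthonormal basis, by an irreducible unitary matrix representation. -/
theorem exists_irrUnitaryRep_of_minimal {ρ : G →* (V →ₗᵢ[ℂ] V)}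
    (hρ : ∀ u v, Continuous fun g => inner ℂ u (ρ g v)) {U : Submodule ℂ V}
    [FiniteDimensional ℂ U] (hU : IsStable ρ U) (hne : U ≠ ⊥)
    (hmin : ∀ W : Submodule ℂ V, IsStable ρ W → W ≤ U → W = ⊥ ∨ W = U) :
    ∃ (π : IrrUnitaryRep G) (b : OrthonormalBasis (Fin π.dim) ℂ U),
      ∀ g i j, π.mat g i j = inner ℂ (b i : V) (ρ g (b j)) := by
  classical
  let b : OrthonormalBasis (Fin (Module.finrank ℂ U)) ℂ U := stdOrthonormalBasis ℂ U
  have expand : ∀ v ∈ U, ∑ i, inner ℂ (b i : V) v • (b i : V) = v := by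
    intro v hv
    have := congrArg Subtype.val (b.sum_repr' ⟨v, hv⟩)
    simpa using this
  let m : G → Matrix (Fin (Module.finrank ℂ U)) (Fin (Module.finrank ℂ U)) ℂ := fun g =>
    Matrix.of fun i j => inner ℂ (b i : V) (ρ g (b j))
  have m_one : m 1 = 1 := by
    ext i j
    have := b.inner_eq_ite i j
    simpa [m, Matrix.one_apply] using this
  have m_mul : ∀ g h, m (g * h) = m g * m h := by
    intro g h
    ext i j
    simp only [m, Matrix.of_apply, Matrix.mul_apply]
    conv_lhs => rw [map_mul, LinearIsometry.coe_mul, Function.comp_apply,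
      ← expand _ (hU h _ (b j).2), map_sum, inner_sum]
    refine Finset.sum_congr rfl fun k _ => ?_
    rw [map_smul, inner_smul_right, mul_comm]
  have m_star : ∀ g, star (m g) = m g⁻¹ := by
    intro g
    ext i j
    simp only [m, Matrix.star_apply, Matrix.of_apply]
    rw [← inner_rep_left, RCLike.star_def, inner_conj_symm]
  let hom : G →* Matrix.unitaryGroup (Fin (Module.finrank ℂ U)) ℂ :=
    { toFun := fun g => ⟨m g, by
        rw [Matrix.mem_unitaryGroup_iff, m_star, ← m_mul, mul_inv_cancel, m_one]⟩
      map_one' := Subtype.ext m_one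
      map_mul' := fun g h => Subtype.ext (m_mul g h) }
  have hdim : 0 < Module.finrank ℂ U := by
    have : Nontrivial U := Submodule.nontrivial_iff_ne_bot.2 hne
    exact Module.finrank_pos
  refine ⟨⟨Module.finrank ℂ U, hdim, hom, ?_, ?_⟩, b, fun g i j => rfl⟩
  · refine Continuous.subtype_mk ?_ _
    exact continuous_matrix fun i j => hρ _ _
  · intro A hA
    have : Nonempty (Fin (Module.finrank ℂ U)) := ⟨⟨0, hdim⟩⟩
    -- Schur's lemma: an eigenspace of the commuting matrix `A` gives a nonzero stable subspace of
    -- `U`, which by minimality is all of `U`.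
    obtain ⟨c, hc⟩ := Module.End.exists_eigenvalue (Matrix.toLin' A)
    obtain ⟨x, hx, hx0⟩ := hc.exists_hasEigenvector
    refine ⟨c, ?_⟩
    let e : (Fin (Module.finrank ℂ U) → ℂ) →ₗ[ℂ] V :=
      U.subtype ∘ₗ (Fintype.linearCombination ℂ (fun i => b i))
    have he : ∀ x, e x = ∑ i, x i • (b i : V) := by
      intro x; simp [e, Fintype.linearCombination_apply]
    have hcoord : ∀ x i, inner ℂ (b i : V) (e x) = x i := by
      intro x i
      have : ∀ j, inner ℂ (b i : V) (b j : V) = if i = j then 1 else 0 := fun j =>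
        b.inner_eq_ite i j
      simp [he, this]
    have hρe : ∀ g x, ρ g (e x) = e ((m g).mulVec x) := by
      intro g x
      have hmem : ρ g (e x) ∈ U := hU g _ (Submodule.coe_mem _)
      rw [← expand _ hmem, he ((m g).mulVec x)]
      refine Finset.sum_congr rfl fun i _ => ?_
      congr 1
      simp [he x, Matrix.mulVec, dotProduct, m, mul_comm]
    let W : Submodule ℂ V := (Module.End.eigenspace (Matrix.toLin' A) c).map e
    have hW : IsStable ρ W := by
      rintro g _ ⟨y, hy, rfl⟩
      refine ⟨(m g).mulVec y, ?_, (hρe g y).symm⟩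
      simp only [SetLike.mem_coe, Module.End.mem_eigenspace_iff, Matrix.toLin'_apply] at hy ⊢
      have h1 : m g * A = A * m g := hA g
      rw [Matrix.mulVec_mulVec, ← h1, ← Matrix.mulVec_mulVec, hy, Matrix.mulVec_smul]
    have hWU : W ≤ U := by
      rintro _ ⟨y, -, rfl⟩
      exact Submodule.coe_mem _
    rcases hmin W hW hWU with h | h
    · exfalso
      apply hx0
      have : e x ∈ W := ⟨x, hx, rfl⟩
      rw [h, Submodule.mem_bot] at this
      ext i
      rw [← hcoord x i, this, inner_zero_right, Pi.zero_apply]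
    · have key : ∀ y, A.mulVec y = c • y := by
        intro y
        have : e y ∈ W := by rw [h]; exact Submodule.coe_mem _
        obtain ⟨z, hz, hzy⟩ := this
        have : z = y := by
          ext i
          rw [← hcoord z i, ← hcoord y i, hzy]
        subst this
        simpa [Module.End.mem_eigenspace_iff] using hz
      ext i j
      have := congrFun (key (Pi.single j 1)) i
      simpa [Matrix.one_apply, Pi.single_apply] using this

theorem irrUnitaryRep_mat_continuous (π : IrrUnitaryRep G) (i j : Fin π.dim) :
    Continuous fun g => π.mat g i j :=
  (continuous_subtype_val.comp π.continuous_hom).matrix_elem i j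

end UnitaryRepresentations

/-! ### Compact self-adjoint intertwiners -/

section CompactSelfAdjoint

variable {V : Type*} [NormedAddCommGroup V] [InnerProductSpace ℂ V]

theorem isStable_eigenspace {G : Type*} [Group G] {ρ : G →* (V →ₗᵢ[ℂ] V)} {A : V →L[ℂ] V}
    (hA : ∀ g v, A (ρ g v) = ρ g (A v)) (c : ℂ) :
    IsStable ρ (Module.End.eigenspace A.toLinearMap c) := by
  intro g u hu
  rw [Module.End.mem_eigenspace_iff, ContinuousLinearMap.coe_coe] at hu ⊢
  rw [hA, hu, map_smul]

/-- The span of the finite-dimensional stable subspaces of a representation. -/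
def finiteVectors {G : Type*} [Group G] (ρ : G →* (V →ₗᵢ[ℂ] V)) : Submodule ℂ V :=
  ⨆ U : {U : Submodule ℂ V // FiniteDimensional ℂ U ∧ IsStable ρ U}, (U : Submodule ℂ V)

theorem le_finiteVectors {G : Type*} [Group G] {ρ : G →* (V →ₗᵢ[ℂ] V)} {U : Submodule ℂ V}
    (hfin : FiniteDimensional ℂ U) (hU : IsStable ρ U) : U ≤ finiteVectors ρ :=
  le_iSup (fun U : {U : Submodule ℂ V // FiniteDimensional ℂ U ∧ IsStable ρ U} =>
    (U : Submodule ℂ V)) ⟨U, hfin, hU⟩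

/-- A compact self-adjoint operator vanishes on vectors orthogonal to all its eigenspaces for
nonzero eigenvalues. -/
theorem apply_eq_zero_of_mem_orthogonal_eigenspaces [CompleteSpace V] {A : V →L[ℂ] V}
    (hA : IsCompactOperator A) (hsymm : A.IsSymmetric) {v : V}
    (hv : ∀ c : ℂ, c ≠ 0 → v ∈ (Module.End.eigenspace A.toLinearMap c)ᗮ) : A v = 0 := by
  have hmem : A v ∈ (⨆ c, Module.End.eigenspace A.toLinearMap c)ᗮ := by
    rw [← Submodule.iInf_orthogonal, Submodule.mem_iInf]
    intro c u hu
    have hu' := Module.End.mem_eigenspace_iff.1 hu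
    have h1 : inner ℂ u (A v) = inner ℂ (A.toLinearMap u) v := (hsymm u v).symm
    rw [h1, hu', inner_smul_left]
    -- The kernel needs no orthogonality hypothesis: there the inner product already carries the
    -- factor `conj c = 0`.
    by_cases hc : c = 0
    · simp [hc]
    · rw [hv c hc u hu, mul_zero]
  rwa [ContinuousLinearMap.orthogonalComplement_iSup_eigenspaces_eq_bot hA hsymm,
    Submodule.mem_bot] at hmem

/-- A compact self-adjoint intertwining operator vanishes on the orthogonal complement of the
finite-dimensional stable subspaces. -/
theorem apply_eq_zero_of_mem_finiteVectors_orthogonal [CompleteSpace V] {G : Type*} [Group G]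
    {ρ : G →* (V →ₗᵢ[ℂ] V)} {A : V →L[ℂ] V} (hcomm : ∀ g v, A (ρ g v) = ρ g (A v))
    (hA : IsCompactOperator A) (hsymm : A.IsSymmetric) {v : V} (hv : v ∈ (finiteVectors ρ)ᗮ) :
    A v = 0 :=
  apply_eq_zero_of_mem_orthogonal_eigenspaces hA hsymm fun c hc =>
    Submodule.orthogonal_le (le_finiteVectors
      (ContinuousLinearMap.finite_dimensional_eigenspace hA c hc)
      (isStable_eigenspace hcomm c)) hv

end CompactSelfAdjoint

/-! ### Normalised Haar measure and its invariances -/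

section NormalisedHaar

variable {G : Type*} [Group G] [TopologicalSpace G] [IsTopologicalGroup G] [CompactSpace G]
  [MeasurableSpace G] [BorelSpace G]

instance isHaarMeasure_normHaar : (normHaar G).IsHaarMeasure :=
  inferInstanceAs (Measure.haarMeasure _).IsHaarMeasure

instance regular_normHaar : (normHaar G).Regular :=
  inferInstanceAs (Measure.haarMeasure _).Regular

instance isProbabilityMeasure_normHaar : IsProbabilityMeasure (normHaar G) :=
  ⟨Measure.haarMeasure_self (K₀ := (⊤ : TopologicalSpace.PositiveCompacts G))⟩

/-- Gives right and inversion invariance: the image of Haar measure under a right translation or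
under inversion is again a left-invariant probability measure. -/
theorem eq_normHaar_of_isMulLeftInvariant (ν : Measure G) [ν.IsMulLeftInvariant]
    [IsProbabilityMeasure ν] : ν = normHaar G := by
  have h := Measure.isMulInvariant_eq_smul_of_compactSpace ν (normHaar G)
  have h1 := congrArg (fun m : Measure G => m Set.univ) h
  simp only [measure_univ, Measure.smul_apply] at h1
  have h2 : ((Measure.haarScalarFactor ν (normHaar G) : NNReal) : ENNReal) = 1 := by
    simpa [ENNReal.smul_def] using h1.symm
  rw [ENNReal.coe_eq_one] at h2
  rw [h, h2, one_smul]

instance isMulRightInvariant_normHaar : (normHaar G).IsMulRightInvariant where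
  map_mul_right_eq_self g := by
    have : IsProbabilityMeasure ((normHaar G).map (· * g)) :=
      Measure.isProbabilityMeasure_map (measurable_mul_const g).aemeasurable
    exact eq_normHaar_of_isMulLeftInvariant _

instance isInvInvariant_normHaar : (normHaar G).IsInvInvariant where
  inv_eq_self := by
    have : IsProbabilityMeasure (normHaar G).inv :=
      Measure.isProbabilityMeasure_map measurable_inv.aemeasurable
    exact eq_normHaar_of_isMulLeftInvariant _

theorem integrable_mul_continuous {f u : G → ℂ} (hf : Integrable f (normHaar G))
    (hu : Continuous u) : Integrable (fun g => f g * u g) (normHaar G) := by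
  obtain ⟨C, hC⟩ := isCompact_univ.exists_bound_of_continuousOn hu.continuousOn
  exact hf.mul_bdd (c := C) hu.aestronglyMeasurable_of_compactSpace
    (Filter.Eventually.of_forall fun x => hC x trivial)

end NormalisedHaar

/-! ### The right regular representation and density of its finite vectors -/

noncomputable section

section RegularRepresentation

variable (G : Type*) [Group G] [TopologicalSpace G] [IsTopologicalGroup G] [CompactSpace G]
  [MeasurableSpace G] [BorelSpace G]

/-- The right regular representation of `G` on `L²(G)`. -/
def rightRegular : G →* (Lp ℂ 2 (normHaar G) →ₗᵢ[ℂ] Lp ℂ 2 (normHaar G)) where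
  toFun g := Lp.compMeasurePreservingₗᵢ ℂ (· * g) (measurePreserving_mul_right (normHaar G) g)
  map_one' := by
    ext1 f
    simp only [mul_one]
    exact Lp.compMeasurePreserving_id_apply f
  map_mul' g h := by
    ext1 f
    have := Lp.compMeasurePreserving_comp_apply f (measurePreserving_mul_right (normHaar G) h)
      (measurePreserving_mul_right (normHaar G) g)
    simp only [Function.comp_def, mul_assoc] at this
    exact this

variable {G}

theorem continuous_rightRegular (f : Lp ℂ 2 (normHaar G)) :
    Continuous fun g => rightRegular G g f := by
  have hc : Continuous fun g : G => ContinuousMap.curry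
      (⟨fun p : G × G => p.2 * p.1, by fun_prop⟩ : C(G × G, G)) g := ContinuousMap.continuous _
  exact Continuous.compMeasurePreservingLp (continuous_const (y := f)) hc
    (fun g => measurePreserving_mul_right (normHaar G) g) (by norm_num)

theorem continuous_inner_rightRegular (κ f : Lp ℂ 2 (normHaar G)) :
    Continuous fun g => inner ℂ κ (rightRegular G g f) :=
  continuous_const.inner (continuous_rightRegular f)

/-- The matrix coefficients `g ↦ ⟪κ, R(g) f⟫` as an operator from `L²(G)` to bounded continuous
functions. -/
def coefficientMap (κ : Lp ℂ 2 (normHaar G)) :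
    Lp ℂ 2 (normHaar G) →L[ℂ] BoundedContinuousFunction G ℂ :=
  LinearMap.mkContinuous
    { toFun := fun f => BoundedContinuousFunction.mkOfCompact
        ⟨fun g => inner ℂ κ (rightRegular G g f), continuous_inner_rightRegular κ f⟩
      map_add' := fun f f' => by ext g; simp [inner_add_right]
      map_smul' := fun c f => by ext g; simp [inner_smul_right] }
    ‖κ‖ (fun f => by
      rw [BoundedContinuousFunction.norm_le (by positivity)]
      intro g
      simpa using norm_inner_le_norm (𝕜 := ℂ) κ (rightRegular G g f))

theorem coefficientMap_apply (κ f : Lp ℂ 2 (normHaar G)) (g : G) :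
    coefficientMap κ f g = inner ℂ κ (rightRegular G g f) := rfl

/-- Arzelà–Ascoli. On the unit ball the coefficients are bounded by `‖κ‖`. Moving the translation
onto `κ` gives `⟪R(g⁻¹)κ, f⟫`, so norm continuity of `g ↦ R(g⁻¹)κ` yields equicontinuity independent
of `f`. -/
theorem isCompactOperator_coefficientMap (κ : Lp ℂ 2 (normHaar G)) :
    IsCompactOperator (coefficientMap κ) := by
  refine (isCompactOperator_iff_isCompact_closure_image_closedBall
    (coefficientMap κ).toLinearMap one_pos).2 ?_
  refine BoundedContinuousFunction.arzela_ascoli (Metric.closedBall (0 : ℂ) ‖κ‖)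
    (isCompact_closedBall _ _) _ ?_ ?_
  · rintro _ g ⟨f, hf, rfl⟩
    rw [mem_closedBall_zero_iff] at hf ⊢
    change ‖inner ℂ κ (rightRegular G g f)‖ ≤ ‖κ‖
    calc _ ≤ ‖κ‖ * ‖rightRegular G g f‖ := norm_inner_le_norm _ _
      _ ≤ ‖κ‖ * 1 := by gcongr; simpa using hf
      _ = ‖κ‖ := mul_one _
  · intro g₀
    rw [Metric.equicontinuousAt_iff_right]
    intro ε hε
    have hc : Continuous fun g : G => rightRegular G g⁻¹ κ :=
      (continuous_rightRegular κ).comp continuous_inv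
    filter_upwards [hc.continuousAt (x := g₀) (Metric.ball_mem_nhds _ hε)]
    rintro g hg ⟨_, f, hf, rfl⟩
    rw [mem_closedBall_zero_iff] at hf
    have hsplit : ∀ g, coefficientMap κ f g = inner ℂ (rightRegular G g⁻¹ κ) f := by
      intro g
      rw [coefficientMap_apply, inner_rep_left, inv_inv]
    change dist (coefficientMap κ f g₀) (coefficientMap κ f g) < ε
    rw [dist_comm, dist_eq_norm, hsplit, hsplit, ← inner_sub_left]
    rw [Set.mem_preimage, Metric.mem_ball, dist_eq_norm] at hg
    calc _ ≤ ‖rightRegular G g⁻¹ κ - rightRegular G g₀⁻¹ κ‖ * ‖f‖ := norm_inner_le_norm _ _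
      _ ≤ ‖rightRegular G g⁻¹ κ - rightRegular G g₀⁻¹ κ‖ * 1 := by gcongr
      _ < ε := by simpa using hg

/-- The operator `f ↦ (g ↦ ⟪κ, R(g) f⟫)` on `L²(G)`. -/
def coefficientOperator (κ : Lp ℂ 2 (normHaar G)) :
    Lp ℂ 2 (normHaar G) →L[ℂ] Lp ℂ 2 (normHaar G) :=
  BoundedContinuousFunction.toLp 2 (normHaar G) ℂ ∘L coefficientMap κ

theorem isCompactOperator_coefficientOperator (κ : Lp ℂ 2 (normHaar G)) :
    IsCompactOperator (coefficientOperator κ) :=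
  (isCompactOperator_coefficientMap κ).clm_comp
    (BoundedContinuousFunction.toLp 2 (normHaar G) ℂ)

theorem coefficientOperator_rightRegular (κ : Lp ℂ 2 (normHaar G)) (h : G)
    (f : Lp ℂ 2 (normHaar G)) :
    coefficientOperator κ (rightRegular G h f) = rightRegular G h (coefficientOperator κ f) := by
  have hmp := measurePreserving_mul_right (normHaar G) h
  have h1 := BoundedContinuousFunction.coeFn_toLp (p := 2) (normHaar G) ℂ (coefficientMap κ f)
  have h2 := BoundedContinuousFunction.coeFn_toLp (p := 2) (normHaar G) ℂ
    (coefficientMap κ (rightRegular G h f))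
  have h3 := Lp.coeFn_compMeasurePreserving (coefficientOperator κ f) hmp
  refine Lp.ext (h2.trans (Filter.EventuallyEq.trans ?_ h3.symm))
  filter_upwards [hmp.quasiMeasurePreserving.ae_eq_comp h1] with g hg
  refine Eq.trans ?_ hg.symm
  simp only [Function.comp_apply, coefficientMap_apply, map_mul, LinearIsometry.coe_mul]

theorem adjoint_rightRegular {T : Lp ℂ 2 (normHaar G) →L[ℂ] Lp ℂ 2 (normHaar G)}
    (hT : ∀ h f, T (rightRegular G h f) = rightRegular G h (T f)) (h : G)
    (f : Lp ℂ 2 (normHaar G)) :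
    T.adjoint (rightRegular G h f) = rightRegular G h (T.adjoint f) := by
  refine ext_inner_right ℂ fun u => ?_
  rw [ContinuousLinearMap.adjoint_inner_left, inner_rep_left, ← hT, inner_rep_left,
    ContinuousLinearMap.adjoint_inner_left]

/-- The vector `f` serves as its own kernel: `A = T*T` is a compact self-adjoint intertwiner, so `A
f = 0` and then `T f = 0`. The coefficient `g ↦ ⟪f, R(g) f⟫` is continuous, hence zero everywhere,
and its value at 1 is `‖f‖²`. -/
theorem finiteVectors_orthogonal : (finiteVectors (rightRegular G))ᗮ = ⊥ := by
  rw [Submodule.eq_bot_iff]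
  intro f hf
  let T := coefficientOperator f
  let A := T.adjoint ∘L T
  have hTcomm := coefficientOperator_rightRegular f
  have hA : ∀ h u, A (rightRegular G h u) = rightRegular G h (A u) := fun h u => by
    simp only [A, T, ContinuousLinearMap.comp_apply, hTcomm, adjoint_rightRegular hTcomm]
  have hcomp : IsCompactOperator A := (isCompactOperator_coefficientOperator f).clm_comp T.adjoint
  have hadj : ∀ u v, inner ℂ (A u) v = inner ℂ u (A v) := fun u v => by
    simp only [A, ContinuousLinearMap.comp_apply, ContinuousLinearMap.adjoint_inner_left,
      ContinuousLinearMap.adjoint_inner_right]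
  have hAf : A f = 0 := apply_eq_zero_of_mem_finiteVectors_orthogonal hA hcomp hadj hf
  have hTf : T f = 0 := by
    rw [← inner_self_eq_zero (𝕜 := ℂ), ← ContinuousLinearMap.adjoint_inner_left]
    show inner ℂ (A f) f = 0
    rw [hAf, inner_zero_left]
  have hSf : coefficientMap f f = 0 :=
    BoundedContinuousFunction.toLp_injective (𝕜 := ℂ) (p := 2) (normHaar G)
      (hTf.trans (map_zero _).symm)
  have h1 := congrArg (fun u : BoundedContinuousFunction G ℂ => u 1) hSf
  simpa [coefficientMap_apply] using h1

theorem dense_finiteVectors : (finiteVectors (rightRegular G)).topologicalClosure = ⊤ := by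
  rw [Submodule.topologicalClosure_eq_top_iff, finiteVectors_orthogonal]

end RegularRepresentation

end

/-! ### Uniqueness of Fourier coefficients -/

section FourierUniqueness

variable {G : Type*} [Group G] [TopologicalSpace G] [IsTopologicalGroup G] [CompactSpace G]
  [MeasurableSpace G] [BorelSpace G]

theorem integral_mul_conj_mat_eq_zero {f : G → ℂ} {π : IrrUnitaryRep G}
    (h : groupFourierCoeff f π = 0) (i j : Fin π.dim) :
    ∫ g, f g * conj (π.mat g i j) ∂(normHaar G) = 0 :=
  congrFun (congrFun h j) i

/-- Complete reducibility, by induction on dimension. For minimal `U` the coefficient is a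
combination of matrix entries of an irreducible `π`. Otherwise `U` splits into the smaller stable
pieces `W` and `Wᗮ ⊓ U`, and stability kills the cross terms. -/
theorem integral_mul_conj_coefficient_eq_zero {V : Type*} [NormedAddCommGroup V]
    [InnerProductSpace ℂ V] {ρ : G →* (V →ₗᵢ[ℂ] V)}
    (hρ : ∀ u v, Continuous fun g => inner ℂ u (ρ g v)) {f : G → ℂ}
    (hf : Integrable f (normHaar G)) (h : ∀ π : IrrUnitaryRep G, groupFourierCoeff f π = 0)
    (U : Submodule ℂ V) [FiniteDimensional ℂ U] (hU : IsStable ρ U) {u v : V} (hu : u ∈ U)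
    (hv : v ∈ U) : ∫ g, f g * conj (inner ℂ u (ρ g v)) ∂(normHaar G) = 0 := by
  induction hn : Module.finrank ℂ U using Nat.strong_induction_on generalizing U u v with
  | _ n ih =>
  subst hn
  by_cases hbot : U = ⊥
  · subst hbot
    rw [Submodule.mem_bot] at hu
    simp [hu]
  by_cases hmin : ∀ W : Submodule ℂ V, IsStable ρ W → W ≤ U → W = ⊥ ∨ W = U
  · obtain ⟨π, b, hπ⟩ := exists_irrUnitaryRep_of_minimal hρ hU hbot hmin
    have expand : ∀ w ∈ U, ∑ i, inner ℂ (b i : V) w • (b i : V) = w := by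
      intro w hw
      have := congrArg Subtype.val (b.sum_repr' ⟨w, hw⟩)
      simpa using this
    have key : ∀ g, f g * conj (inner ℂ u (ρ g v)) =
        ∑ i, ∑ j, (inner ℂ (b i : V) u * conj (inner ℂ (b j : V) v)) *
          (f g * conj (π.mat g i j)) := by
      intro g
      conv_lhs => rw [← expand u hu, ← expand v hv]
      simp only [map_sum, map_smul, sum_inner, inner_sum, inner_smul_left, inner_smul_right,
        map_mul, Finset.mul_sum, Complex.conj_conj, hπ]
      rw [Finset.sum_comm]
      refine Finset.sum_congr rfl fun i _ => Finset.sum_congr rfl fun j _ => ?_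
      ring
    have hint : ∀ i j, Integrable (fun g => (inner ℂ (b i : V) u * conj (inner ℂ (b j : V) v)) *
        (f g * conj (π.mat g i j))) (normHaar G) := fun i j =>
      (integrable_mul_continuous hf
        (Complex.continuous_conj.comp (irrUnitaryRep_mat_continuous π i j))).const_mul _
    simp_rw [key]
    rw [integral_finsetSum _ fun i _ => integrable_finsetSum _ fun j _ => hint i j]
    refine Finset.sum_eq_zero fun i _ => ?_
    rw [integral_finsetSum _ fun j _ => hint i j]
    refine Finset.sum_eq_zero fun j _ => ?_
    rw [integral_const_mul, integral_mul_conj_mat_eq_zero (h π), mul_zero]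
  · push Not at hmin
    obtain ⟨W, hW, hWU, hW0, hW1⟩ := hmin
    have : FiniteDimensional ℂ W := Submodule.finiteDimensional_of_le hWU
    have hlt1 : W < U := lt_of_le_of_ne hWU hW1
    have hlt2 : Wᗮ ⊓ U < U := by
      refine lt_of_le_of_ne inf_le_right fun heq => hW0 ?_
      have h1 : W ≤ Wᗮ := hWU.trans (inf_eq_right.1 heq)
      rw [Submodule.eq_bot_iff]
      intro x hx
      exact inner_self_eq_zero.1 (h1 hx x hx)
    have hfin2 : FiniteDimensional ℂ (Wᗮ ⊓ U : Submodule ℂ V) :=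
      Submodule.finiteDimensional_of_le inf_le_right
    have hst2 : IsStable ρ (Wᗮ ⊓ U) := hW.orthogonal.inf hU
    obtain ⟨u₁, hu₁, u₂, hu₂, rfl⟩ := W.exists_add_mem_mem_orthogonal u
    obtain ⟨v₁, hv₁, v₂, hv₂, rfl⟩ := W.exists_add_mem_mem_orthogonal v
    have hu₂U : u₂ ∈ U := (Submodule.add_mem_iff_right U (hWU hu₁)).1 hu
    have hv₂U : v₂ ∈ U := (Submodule.add_mem_iff_right U (hWU hv₁)).1 hv
    have h1 := ih _ (Submodule.finrank_lt_finrank_of_lt hlt1) W hW hu₁ hv₁ rfl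
    have h2 := ih _ (Submodule.finrank_lt_finrank_of_lt hlt2) (Wᗮ ⊓ U) hst2
      ⟨hu₂, hu₂U⟩ ⟨hv₂, hv₂U⟩ rfl
    have key : ∀ g, f g * conj (inner ℂ (u₁ + u₂) (ρ g (v₁ + v₂))) =
        f g * conj (inner ℂ u₁ (ρ g v₁)) + f g * conj (inner ℂ u₂ (ρ g v₂)) := by
      intro g
      have c1 : inner ℂ u₁ (ρ g v₂) = 0 := hW.orthogonal g _ hv₂ _ hu₁
      have c2 : inner ℂ u₂ (ρ g v₁) = 0 := inner_eq_zero_symm.1 (hu₂ _ (hW g _ hv₁))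
      simp [c1, c2, mul_add]
    simp_rw [key]
    rw [integral_add, h1, h2, add_zero]
    · exact integrable_mul_continuous hf (Complex.continuous_conj.comp (hρ _ _))
    · exact integrable_mul_continuous hf (Complex.continuous_conj.comp (hρ _ _))

/-- If `u` lies in a finite-dimensional stable `U`, then `κ` may be replaced by its projection to
`U`. Density handles general `u`: the pairing is continuous in `u` although `f` is only integrable,
because `coefficientMap` takes values in the sup norm. -/
theorem integral_conj_mul_coefficientMap_eq_zero {f : G → ℂ} (hf : Integrable f (normHaar G))
    (h : ∀ π : IrrUnitaryRep G, groupFourierCoeff f π = 0) (κ u : Lp ℂ 2 (normHaar G)) :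
    ∫ g, conj (f g) * coefficientMap κ u g ∂(normHaar G) = 0 := by
  have hfc : Integrable (fun g => conj (f g)) (normHaar G) :=
    Complex.conjCLE.toContinuousLinearMap.integrable_comp hf
  let L : BoundedContinuousFunction G ℂ →L[ℂ] ℂ := LinearMap.mkContinuous
    { toFun := fun φ => ∫ g, conj (f g) * φ g ∂(normHaar G)
      map_add' := fun φ ψ => by
        simp only [BoundedContinuousFunction.coe_add, Pi.add_apply, mul_add]
        exact integral_add (integrable_mul_continuous hfc φ.continuous)
          (integrable_mul_continuous hfc ψ.continuous)
      map_smul' := fun c φ => by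
        simp only [BoundedContinuousFunction.coe_smul, smul_eq_mul, RingHom.id_apply,
          mul_left_comm _ c]
        exact integral_const_mul _ _ }
    (∫ g, ‖f g‖ ∂(normHaar G)) (fun φ => by
      rw [← integral_mul_const]
      refine norm_integral_le_of_norm_le (hf.norm.mul_const _)
        (Filter.Eventually.of_forall fun g => ?_)
      rw [norm_mul, RCLike.norm_conj]
      gcongr
      exact φ.norm_coe_le_norm g)
  let Z : Submodule ℂ (Lp ℂ 2 (normHaar G)) := (L ∘L coefficientMap κ).ker
  have hZ : IsClosed (Z : Set (Lp ℂ 2 (normHaar G))) := (L ∘L coefficientMap κ).isClosed_ker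
  have hle : finiteVectors (rightRegular G) ≤ Z := by
    refine iSup_le ?_
    rintro ⟨U, hfin, hU⟩ u hu
    have := integral_mul_conj_coefficient_eq_zero continuous_inner_rightRegular hf h U hU
      (U.starProjection_apply_mem κ) hu
    have h2 := congrArg conj this
    rw [← integral_conj, map_zero] at h2
    refine Eq.trans (integral_congr_ae (Filter.Eventually.of_forall fun g => ?_)) h2
    change conj (f g) * inner ℂ κ (rightRegular G g u) = _
    simp only [map_mul, Complex.conj_conj]
    rw [Submodule.inner_starProjection_left_eq_right,
      Submodule.starProjection_eq_self_iff.2 (hU g u hu)]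
  have htop : Z = ⊤ := by
    rw [eq_top_iff, ← dense_finiteVectors]
    exact Submodule.topologicalClosure_minimal _ hle hZ
  have : u ∈ Z := by rw [htop]; trivial
  exact this

theorem continuous_integral_mul_translate [SecondCountableTopology G] {f : G → ℂ}
    (hf : Integrable f (normHaar G))
    (u : C(G, ℂ)) : Continuous fun x => ∫ g, f g * u (x * g) ∂(normHaar G) := by
  obtain ⟨C, hC⟩ := isCompact_univ.exists_bound_of_continuousOn u.continuous.continuousOn
  refine continuous_of_dominated (bound := fun g => ‖f g‖ * C) (fun x => ?_) (fun x => ?_)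
    (hf.norm.mul_const _) (Filter.Eventually.of_forall fun g => by fun_prop)
  · exact (integrable_mul_continuous hf (by fun_prop)).aestronglyMeasurable
  · refine Filter.Eventually.of_forall fun g => ?_
    rw [norm_mul]
    gcongr
    exact hC _ trivial

/-- A continuous function is orthogonal to every integrable function whose Fourier coefficients
vanish. -/
theorem integral_conj_mul_eq_zero_of_groupFourierCoeff [SecondCountableTopology G] {f : G → ℂ}
    (hf : Integrable f (normHaar G)) (h : ∀ π : IrrUnitaryRep G, groupFourierCoeff f π = 0)
    (u : C(G, ℂ)) : ∫ g, conj (f g) * u g ∂(normHaar G) = 0 := by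
  have hfc : Integrable (fun g => conj (f g)) (normHaar G) :=
    Complex.conjCLE.toContinuousLinearMap.integrable_comp hf
  -- With `φ(x) = ∫ conj(f(g)) u(xg) dg` as kernel, Fubini turns the vanishing pairing into `‖φ‖² =
  -- 0`. Then `φ = 0`, and `φ(1)` is the required integral.
  let φ : C(G, ℂ) := ⟨_, continuous_integral_mul_translate hfc u⟩
  let κ : Lp ℂ 2 (normHaar G) := ContinuousMap.toLp 2 (normHaar G) ℂ φ
  let υ : Lp ℂ 2 (normHaar G) := ContinuousMap.toLp 2 (normHaar G) ℂ u
  have hcoef : ∀ g, coefficientMap κ υ g = ∫ x, conj (φ x) * u (x * g) ∂(normHaar G) := by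
    intro g
    rw [coefficientMap_apply, L2.inner_def]
    have h1 := ContinuousMap.coeFn_toLp (p := 2) (𝕜 := ℂ) (normHaar G) φ
    have hmp := measurePreserving_mul_right (normHaar G) g
    have h2 := hmp.quasiMeasurePreserving.ae_eq_comp
      (ContinuousMap.coeFn_toLp (p := 2) (𝕜 := ℂ) (normHaar G) u)
    have h3 := Lp.coeFn_compMeasurePreserving υ hmp
    refine integral_congr_ae ?_
    filter_upwards [h1, h2, h3] with x hx1 hx2 hx3
    have hx4 : (rightRegular G g υ : G → ℂ) x = u (x * g) := hx3.trans hx2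
    rw [hx4, hx1, RCLike.inner_apply, mul_comm]
  have hzero := integral_conj_mul_coefficientMap_eq_zero hf h κ υ
  have hF : Integrable (Function.uncurry fun g x : G => conj (f g) * (conj (φ x) * u (x * g)))
      ((normHaar G).prod (normHaar G)) := by
    have hc : Continuous fun p : G × G => conj (φ p.2) * u (p.2 * p.1) := by fun_prop
    obtain ⟨C, hC⟩ := isCompact_univ.exists_bound_of_continuousOn hc.continuousOn
    exact (hfc.comp_fst (normHaar G)).mul_bdd (c := C) hc.aestronglyMeasurable
      (Filter.Eventually.of_forall fun x => hC x trivial)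
  have hκ : inner ℂ κ κ = 0 := by
    rw [← hzero]
    simp_rw [hcoef, ← integral_const_mul]
    rw [integral_integral_swap hF, L2.inner_def]
    refine integral_congr_ae ?_
    filter_upwards [ContinuousMap.coeFn_toLp (p := 2) (𝕜 := ℂ) (normHaar G) φ] with x hx
    simp_rw [mul_left_comm _ (conj (φ x))]
    rw [integral_const_mul, hx, RCLike.inner_apply, mul_comm]
    rfl
  have hφ : φ = 0 := by
    refine ContinuousMap.toLp_injective (p := 2) (𝕜 := ℂ) (normHaar G) ?_
    rw [map_zero]
    exact inner_self_eq_zero.1 hκ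
  have := congrArg (fun ψ : C(G, ℂ) => ψ 1) hφ
  simpa [φ] using this

/-- Passes from the chosen representatives to all irreducible representations. -/
theorem groupFourierCoeff_eq_zero_of_equivalent {f : G → ℂ} (hf : Integrable f (normHaar G))
    {π₁ π₂ : IrrUnitaryRep G} (h : π₁.Equivalent π₂) (h₂ : groupFourierCoeff f π₂ = 0) :
    groupFourierCoeff f π₁ = 0 := by
  obtain ⟨A, B, hAB, -, hA⟩ := h
  have hmat : ∀ g, π₁.mat g = A * π₂.mat g * B := fun g => by
    rw [← hA, Matrix.mul_assoc, hAB, Matrix.mul_one]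
  ext i j
  have key : ∀ g, f g * (π₁.mat g).conjTranspose i j =
      ∑ l, ∑ k, conj (A j k) * conj (B l i) * (f g * conj (π₂.mat g k l)) := by
    intro g
    simp only [hmat, Matrix.conjTranspose_apply, Matrix.mul_apply, RCLike.star_def, map_sum,
      map_mul, Finset.sum_mul, Finset.mul_sum]
    refine Finset.sum_congr rfl fun l _ => Finset.sum_congr rfl fun k _ => ?_
    ring
  have hint : ∀ k l, Integrable (fun g => conj (A j k) * conj (B l i) *
      (f g * conj (π₂.mat g k l))) (normHaar G) := fun k l =>
    (integrable_mul_continuous hf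
      (Complex.continuous_conj.comp (irrUnitaryRep_mat_continuous π₂ k l))).const_mul _
  simp only [groupFourierCoeff, Matrix.of_apply, Matrix.zero_apply, key]
  rw [integral_finsetSum _ fun l _ => integrable_finsetSum _ fun k _ => hint k l]
  refine Finset.sum_eq_zero fun l _ => ?_
  rw [integral_finsetSum _ fun k _ => hint k l]
  refine Finset.sum_eq_zero fun k _ => ?_
  rw [integral_const_mul, integral_mul_conj_mat_eq_zero h₂, mul_zero]

end FourierUniqueness

/-- On a compact Lie group, an integrable function whose Fourier coefficients all vanish is zero
almost everywhere. -/
theorem ae_eq_zero_of_groupFourierCoeff_eq_zero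
    {E : Type*} [NormedAddCommGroup E] [NormedSpace ℝ E] [FiniteDimensional ℝ E]
    {G : Type*} [Group G] [TopologicalSpace G] [ChartedSpace E G] [LieGroup 𝓘(ℝ, E) ∞ G]
    [IsTopologicalGroup G] [T2Space G] [CompactSpace G] [MeasurableSpace G] [BorelSpace G]
    (π : Dual G → IrrUnitaryRep G) (hπ : ∀ c, (π c).toDual = c) {f : G → ℂ}
    (hf : Integrable f (normHaar G)) (h : ∀ c, groupFourierCoeff f (π c) = 0) :
    f =ᵐ[normHaar G] 0 := by
  have : SecondCountableTopology G := ChartedSpace.secondCountable_of_sigmaCompact E G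
  have hall : ∀ π' : IrrUnitaryRep G, groupFourierCoeff f π' = 0 := fun π' =>
    groupFourierCoeff_eq_zero_of_equivalent hf
      (IrrUnitaryRep.equivalent_equivalence.symm (Quotient.exact (hπ π'.toDual)))
      (h π'.toDual)
  have hfc : Integrable (fun g => conj (f g)) (normHaar G) :=
    Complex.conjCLE.toContinuousLinearMap.integrable_comp hf
  -- Smooth test functions are continuous, so they are covered by the pairing result, and they
  -- suffice to detect a locally integrable function.
  have := ae_eq_zero_of_integral_contMDiff_smul_eq_zero 𝓘(ℝ, E) hfc.locallyIntegrable
    fun u hu _ => by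
      have h1 := integral_conj_mul_eq_zero_of_groupFourierCoeff hf hall
        ⟨fun g => (u g : ℂ), Complex.continuous_ofReal.comp hu.continuous⟩
      simpa [mul_comm] using h1
  filter_upwards [this] with g hg
  simpa using hg

/-! ### Fourier coefficients of translates -/

section Translation

theorem IrrUnitaryRep.mat_mul {G : Type*} [Group G] [TopologicalSpace G]
    (π : IrrUnitaryRep G) (g h : G) :
    π.mat (g * h) = π.mat g * π.mat h := by
  simp [IrrUnitaryRep.mat]

theorem IrrUnitaryRep.conjTranspose_mat {G : Type*} [Group G] [TopologicalSpace G]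
    (π : IrrUnitaryRep G) (g : G) :
    (π.mat g).conjTranspose = π.mat g⁻¹ := by
  simp [IrrUnitaryRep.mat, Matrix.star_eq_conjTranspose]

variable {G : Type*} [Group G] [TopologicalSpace G] [IsTopologicalGroup G] [CompactSpace G]
  [MeasurableSpace G] [BorelSpace G]

theorem groupFourierCoeff_mul {f : G → ℂ} (hf : Integrable f (normHaar G)) (π : IrrUnitaryRep G)
    (A : Matrix (Fin π.dim) (Fin π.dim) ℂ) (i j : Fin π.dim) :
    (groupFourierCoeff f π * A) i j =
      ∫ g, f g * ((π.mat g).conjTranspose * A) i j ∂(normHaar G) := by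
  simp only [Matrix.mul_apply, groupFourierCoeff, Matrix.of_apply, Finset.mul_sum]
  rw [integral_finsetSum]
  · refine Finset.sum_congr rfl fun k _ => ?_
    rw [← integral_mul_const]
    simp only [mul_assoc]
  · intro k _
    simp only [← mul_assoc]
    exact (integrable_mul_continuous hf
      (Complex.continuous_conj.comp (irrUnitaryRep_mat_continuous π k i))).mul_const _

theorem mul_groupFourierCoeff {f : G → ℂ} (hf : Integrable f (normHaar G)) (π : IrrUnitaryRep G)
    (A : Matrix (Fin π.dim) (Fin π.dim) ℂ) (i j : Fin π.dim) :
    (A * groupFourierCoeff f π) i j =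
      ∫ g, f g * (A * (π.mat g).conjTranspose) i j ∂(normHaar G) := by
  simp only [Matrix.mul_apply, groupFourierCoeff, Matrix.of_apply, Finset.mul_sum]
  rw [integral_finsetSum]
  · refine Finset.sum_congr rfl fun k _ => ?_
    rw [← integral_const_mul]
    simp only [mul_left_comm (A i k)]
  · intro k _
    simp only [mul_left_comm _ (A i k)]
    exact (integrable_mul_continuous hf
      (Complex.continuous_conj.comp (irrUnitaryRep_mat_continuous π j k))).const_mul _

/-- The coefficient integrates `π(g)* = π(g⁻¹)`, which reverses products, so left translation acts
on the right. -/
theorem groupFourierCoeff_comp_mul_left {f : G → ℂ} (hf : Integrable f (normHaar G))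
    (π : IrrUnitaryRep G) (h : G) :
    groupFourierCoeff (fun g => f (h * g)) π = groupFourierCoeff f π * π.mat h := by
  ext i j
  rw [groupFourierCoeff_mul hf, ← integral_mul_left_eq_self _ h]
  refine integral_congr_ae (Filter.Eventually.of_forall fun g => ?_)
  simp only [IrrUnitaryRep.conjTranspose_mat, ← IrrUnitaryRep.mat_mul]
  simp

theorem groupFourierCoeff_comp_mul_right {f : G → ℂ} (hf : Integrable f (normHaar G))
    (π : IrrUnitaryRep G) (h : G) :
    groupFourierCoeff (fun g => f (g * h)) π = π.mat h * groupFourierCoeff f π := by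
  ext i j
  rw [mul_groupFourierCoeff hf, ← integral_mul_right_eq_self _ h]
  refine integral_congr_ae (Filter.Eventually.of_forall fun g => ?_)
  simp only [IrrUnitaryRep.conjTranspose_mat, ← IrrUnitaryRep.mat_mul]
  simp

theorem groupFourierCoeff_congr {f f' : G → ℂ} (h : f =ᵐ[normHaar G] f') (π : IrrUnitaryRep G) :
    groupFourierCoeff f π = groupFourierCoeff f' π := by
  ext i j
  refine integral_congr_ae ?_
  filter_upwards [h] with g hg
  rw [hg]

theorem groupFourierCoeff_sub {f f' : G → ℂ} (hf : Integrable f (normHaar G))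
    (hf' : Integrable f' (normHaar G)) (π : IrrUnitaryRep G) :
    groupFourierCoeff (f - f') π = groupFourierCoeff f π - groupFourierCoeff f' π := by
  ext i j
  have hc : Continuous fun g => (π.mat g).conjTranspose i j :=
    Complex.continuous_conj.comp (irrUnitaryRep_mat_continuous π j i)
  simp only [groupFourierCoeff, Matrix.sub_apply, Matrix.of_apply, Pi.sub_apply, sub_mul]
  exact integral_sub (integrable_mul_continuous hf hc) (integrable_mul_continuous hf' hc)

end Translation

/-! ### The averaging matrix of the stabiliser -/

section Stabiliser

variable {G : Type*} [Group G] [TopologicalSpace G] [IsTopologicalGroup G] [CompactSpace G]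
  [MeasurableSpace G] [BorelSpace G]
  {X : Type*} [TopologicalSpace X] [T2Space X] [MulAction G X] [ContinuousSMul G X]

theorem integrable_mat_stabilizer (x₀ : X) (π : IrrUnitaryRep G) (i j : Fin π.dim) :
    Integrable (fun h : MulAction.stabilizer G x₀ => π.mat (h : G) i j)
      (normHaar (MulAction.stabilizer G x₀)) := by
  simpa using integrable_mul_continuous
    (integrable_const (1 : ℂ) (μ := normHaar (MulAction.stabilizer G x₀)))
    ((irrUnitaryRep_mat_continuous π i j).comp continuous_subtype_val)

theorem stabCoeff_mul (x₀ : X) (π : IrrUnitaryRep G) (A : Matrix (Fin π.dim) (Fin π.dim) ℂ)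
    (i j : Fin π.dim) : (stabCoeff x₀ π * A) i j =
      ∫ h : MulAction.stabilizer G x₀, (π.mat (h : G) * A) i j
        ∂(normHaar (MulAction.stabilizer G x₀)) := by
  simp only [Matrix.mul_apply, stabCoeff, Matrix.of_apply]
  rw [integral_finsetSum _ fun k _ => (integrable_mat_stabilizer x₀ π i k).mul_const _]
  exact Finset.sum_congr rfl fun k _ => (integral_mul_const _ _).symm

theorem mul_stabCoeff (x₀ : X) (π : IrrUnitaryRep G) (A : Matrix (Fin π.dim) (Fin π.dim) ℂ)
    (i j : Fin π.dim) : (A * stabCoeff x₀ π) i j =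
      ∫ h : MulAction.stabilizer G x₀, (A * π.mat (h : G)) i j
        ∂(normHaar (MulAction.stabilizer G x₀)) := by
  simp only [Matrix.mul_apply, stabCoeff, Matrix.of_apply]
  rw [integral_finsetSum _ fun k _ => (integrable_mat_stabilizer x₀ π k j).const_mul _]
  exact Finset.sum_congr rfl fun k _ => (integral_const_mul _ _).symm

theorem stabCoeff_mul_of_invariant {x₀ : X} {π : IrrUnitaryRep G}
    {A : Matrix (Fin π.dim) (Fin π.dim) ℂ}
    (h : ∀ g ∈ MulAction.stabilizer G x₀, π.mat g * A = A) : stabCoeff x₀ π * A = A := by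
  ext i j
  simp [stabCoeff_mul, fun g : MulAction.stabilizer G x₀ => h g g.2]

theorem mul_stabCoeff_of_invariant {x₀ : X} {π : IrrUnitaryRep G}
    {A : Matrix (Fin π.dim) (Fin π.dim) ℂ}
    (h : ∀ g ∈ MulAction.stabilizer G x₀, A * π.mat g = A) : A * stabCoeff x₀ π = A := by
  ext i j
  simp [mul_stabCoeff, fun g : MulAction.stabilizer G x₀ => h g g.2]

theorem stabCoeff_mul_mat (x₀ : X) (π : IrrUnitaryRep G) {g : G}
    (hg : g ∈ MulAction.stabilizer G x₀) : stabCoeff x₀ π * π.mat g = stabCoeff x₀ π := by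
  ext i j
  rw [stabCoeff_mul]
  simp only [← IrrUnitaryRep.mat_mul]
  exact integral_mul_right_eq_self
    (fun h : MulAction.stabilizer G x₀ => π.mat (h : G) i j) ⟨g, hg⟩

end Stabiliser

/-! ### Zonality read on the group -/

section Lift

theorem measurable_orbitMap {G X : Type*} [Group G] [TopologicalSpace G]
    [MeasurableSpace G] [BorelSpace G] [TopologicalSpace X] [MulAction G X] [ContinuousSMul G X]
    [MeasurableSpace X] [BorelSpace X] (x₀ : X) : Measurable fun g : G => g • x₀ :=
  (continuous_id.smul continuous_const : Continuous fun g : G => g • x₀).measurable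

theorem lift_mul_of_mem_stabilizer {G X : Type*} [Group G] [MulAction G X] (x₀ : X) (f : X → ℂ)
    (g : G) {h : G}
    (hh : h ∈ MulAction.stabilizer G x₀) : lift G x₀ f (g * h) = lift G x₀ f g := by
  simp [lift, mul_smul, MulAction.mem_stabilizer_iff.1 hh]

variable {G : Type*} [Group G] [TopologicalSpace G] [IsTopologicalGroup G] [CompactSpace G]
  [MeasurableSpace G] [BorelSpace G]
  {X : Type*} [TopologicalSpace X] [MulAction G X] [ContinuousSMul G X]
  [MeasurableSpace X] [BorelSpace X]

theorem measurePreserving_smul_homMeasure (x₀ : X) (h : G) :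
    MeasurePreserving (fun x : X => h • x) (homMeasure G x₀) (homMeasure G x₀) := by
  have hm : Measurable fun x : X => h • x := (continuous_const_smul h).measurable
  refine ⟨hm, ?_⟩
  rw [homMeasure, Measure.map_map hm (measurable_orbitMap x₀)]
  have : (fun x : X => h • x) ∘ (fun g : G => g • x₀) = (fun g : G => g • x₀) ∘ (h * ·) := by
    ext g
    simp [mul_smul]
  rw [this, ← Measure.map_map (measurable_orbitMap x₀) (measurable_const_mul h),
    map_mul_left_eq_self]

theorem memLp_lift {x₀ : X} {f : X → ℂ} {q : ENNReal} (hf : MemLp f q (homMeasure G x₀)) :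
    MemLp (lift G x₀ f) q (normHaar G) :=
  hf.comp_of_map (measurable_orbitMap x₀).aemeasurable

theorem memLp_involution {f : G → ℂ} {q : ENNReal} (hf : MemLp f q (normHaar G)) :
    MemLp (involution f) q (normHaar G) :=
  (hf.comp_measurePreserving (Measure.measurePreserving_inv (normHaar G))).star

/-- The measure on X is a pushforward, so a null-measurable set is null iff its preimage in G is.
Measurability of `φ` makes the exceptional set null-measurable. -/
theorem isZonal_iff_lift {x₀ : X} {φ : X → ℂ}
    (hφ : AEStronglyMeasurable φ (homMeasure G x₀)) :
    IsZonal G x₀ φ ↔ ∀ h ∈ MulAction.stabilizer G x₀,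
      (fun g => lift G x₀ φ (h * g)) =ᵐ[normHaar G] lift G x₀ φ := by
  refine forall₂_congr fun h _ => ?_
  have h1 : AEMeasurable (fun x => φ (h • x)) (homMeasure G x₀) :=
    (hφ.comp_measurePreserving (measurePreserving_smul_homMeasure x₀ h)).aemeasurable
  have h2 : NullMeasurableSet {x | φ (h • x) = φ x} (homMeasure G x₀) :=
    nullMeasurableSet_eq_fun h1 hφ.aemeasurable
  rw [Filter.EventuallyEq, ae_iff, Filter.EventuallyEq, ae_iff, homMeasure,
    ← Set.compl_ofPred (p := fun x => φ (h • x) = φ x),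
    Measure.map_apply₀ (measurable_orbitMap x₀).aemeasurable h2.compl]
  simp [lift, mul_smul, Set.compl_ofPred]

/-- The lift of `ψ` is right invariant at every point, and inversion turns this into left invariance
of the lift of `φ`. -/
theorem isZonal_of_involution_lift_ae_eq {x₀ : X} {φ ψ : X → ℂ}
    (hφ : AEStronglyMeasurable φ (homMeasure G x₀))
    (h : involution (lift G x₀ φ) =ᵐ[normHaar G] lift G x₀ ψ) : IsZonal G x₀ φ := by
  rw [isZonal_iff_lift hφ]
  intro k hk
  have hinv := Measure.measurePreserving_inv (normHaar G)
  have h1 := hinv.quasiMeasurePreserving.ae_eq_comp h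
  have h2 := (measurePreserving_mul_left (normHaar G) k).quasiMeasurePreserving.ae_eq_comp h1
  filter_upwards [h1, h2] with g hg1 hg2
  simp only [Function.comp_apply, involution, inv_inv, mul_inv_rev] at hg1 hg2
  rw [lift_mul_of_mem_stabilizer _ _ _ (inv_mem hk), ← hg1] at hg2
  exact (starRingEnd ℂ).injective hg2

theorem involution_lift_mul_ae_eq {x₀ : X} {φ : X → ℂ}
    (hφ : AEStronglyMeasurable φ (homMeasure G x₀)) (hz : IsZonal G x₀ φ) {h : G}
    (hh : h ∈ MulAction.stabilizer G x₀) :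
    (fun g => involution (lift G x₀ φ) (g * h)) =ᵐ[normHaar G] involution (lift G x₀ φ) := by
  have h1 := (isZonal_iff_lift hφ).1 hz _ (inv_mem hh)
  have h2 := (Measure.measurePreserving_inv (normHaar G)).quasiMeasurePreserving.ae_eq_comp h1
  filter_upwards [h2] with g hg
  simp only [Function.comp_apply] at hg
  simp only [involution, mul_inv_rev, hg]

end Lift

/-! ### Descent of right-invariant functions to the homogeneous space -/

section Descent

variable {G : Type*} [Group G] [TopologicalSpace G] [IsTopologicalGroup G] [CompactSpace G]
  [T2Space G] [SecondCountableTopology G] [MeasurableSpace G] [BorelSpace G]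
  {X : Type*} [TopologicalSpace X] [T2Space X] [MulAction G X] [ContinuousSMul G X]
  [MulAction.IsPretransitive G X] [MeasurableSpace X] [BorelSpace X]

/-- The orbit map is an open continuous surjection, so X is second countable. A measurable
surjection from a standard Borel space onto such an X detects measurability. -/
theorem measurable_of_measurable_lift (x₀ : X) {ψ : X → ℂ} (h : Measurable (lift G x₀ ψ)) :
    Measurable ψ := by
  have hc : Continuous fun g : G => g • x₀ := by fun_prop
  have hs : Function.Surjective fun g : G => g • x₀ := MulAction.surjective_smul G x₀
  have : CompactSpace X := hs.compactSpace hc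
  have ho : IsOpenMap fun g : G => g • x₀ := isOpenMap_smul_of_sigmaCompact x₀
  have : SecondCountableTopology X :=
    (ho.isQuotientMap hc hs).secondCountableTopology ho
  have : TopologicalSpace.MetrizableSpace G :=
    TopologicalSpace.metrizableSpace_of_t3_secondCountable G
  let _ : MetricSpace G := TopologicalSpace.metrizableSpaceMetric G
  exact (Measurable.measurable_comp_iff_of_surjective hc.measurable hs).1 h

/-- A function on `G` that is invariant almost everywhere under right translation by each element
of the stabiliser agrees almost everywhere with the lift of a function on `X`. -/
theorem exists_memLp_lift_ae_eq (x₀ : X) {q : ENNReal} {K : G → ℂ} (hK : MemLp K q (normHaar G))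
    (hinv : ∀ h ∈ MulAction.stabilizer G x₀, (fun g => K (g * h)) =ᵐ[normHaar G] K) :
    ∃ ψ : X → ℂ, MemLp ψ q (homMeasure G x₀) ∧ K =ᵐ[normHaar G] lift G x₀ ψ := by
  let H := MulAction.stabilizer G x₀
  obtain ⟨K', hK', hKK'⟩ := hK.aestronglyMeasurable
  have hinv' : ∀ h ∈ H, ∀ᵐ g ∂(normHaar G), K' (g * h) = K' g := by
    intro h hh
    have h1 := (measurePreserving_mul_right (normHaar G) h).quasiMeasurePreserving.ae_eq_comp hKK'
    filter_upwards [hKK', h1, hinv h hh] with g hg1 hg2 hg3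
    rw [← hg1, ← hg3]
    exact hg2.symm
  have hmeas : Measurable fun p : G × H => K' (p.1 * (p.2 : G)) :=
    hK'.measurable.comp (measurable_fst.mul (measurable_subtype_coe.comp measurable_snd))
  -- The section `s` need not be measurable: averaging over H removes the dependence on the choice,
  -- and measurability of `ψ` is recovered from its lift.
  choose s hs using fun x : X => MulAction.exists_smul_eq G x₀ x
  let ψ : X → ℂ := fun x => ∫ h : H, K' (s x * h) ∂(normHaar H)
  have hψ : ∀ g, lift G x₀ ψ g = ∫ h : H, K' (g * h) ∂(normHaar H) := by
    intro g
    have hmem : g⁻¹ * s (g • x₀) ∈ H := by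
      rw [MulAction.mem_stabilizer_iff, mul_smul, hs, inv_smul_smul]
    have := integral_mul_left_eq_self (μ := normHaar H) (fun h : H => K' (g * h))
      ⟨g⁻¹ * s (g • x₀), hmem⟩
    rw [← this]
    simp [lift, ψ, mul_assoc]
  have hψm : Measurable (lift G x₀ ψ) := by
    have : lift G x₀ ψ = fun g => ∫ h : H, K' (g * h) ∂(normHaar H) := funext hψ
    rw [this]
    exact (hmeas.stronglyMeasurable.integral_prod_right (ν := normHaar H)).measurable
  have hset : MeasurableSet {p : H × G | K' (p.2 * (p.1 : G)) = K' p.2} :=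
    measurableSet_eq_fun (hmeas.comp measurable_swap) (hK'.measurable.comp measurable_snd)
  -- The null set in `hinv'` depends on `h`; Fubini exchanges the quantifiers, so for almost every
  -- `g` the average over H is `K' g`.
  have hae : ∀ᵐ g ∂(normHaar G), ∀ᵐ h : H ∂(normHaar H), K' (g * h) = K' g :=
    (Measure.ae_ae_comm hset).1 (Filter.Eventually.of_forall fun h => hinv' h h.2)
  have hKψ : K =ᵐ[normHaar G] lift G x₀ ψ := by
    filter_upwards [hKK', hae] with g hg1 hg2
    rw [hg1, hψ, integral_congr_ae hg2]
    simp
  refine ⟨ψ, ?_, hKψ⟩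
  exact (memLp_map_measure_iff
    (measurable_of_measurable_lift x₀ hψm).aestronglyMeasurable
    (measurable_orbitMap x₀).aemeasurable).2 (hK.ae_eq hKψ)

theorem isZonal_iff_exists_involution (x₀ : X) {q : ENNReal} {φ : X → ℂ}
    (hφ : MemLp φ q (homMeasure G x₀)) :
    IsZonal G x₀ φ ↔ ∃ ψ : X → ℂ, MemLp ψ q (homMeasure G x₀) ∧
      involution (lift G x₀ φ) =ᵐ[normHaar G] lift G x₀ ψ :=
  ⟨fun hz => exists_memLp_lift_ae_eq x₀ (memLp_involution (memLp_lift hφ)) fun _ hh =>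
      involution_lift_mul_ae_eq hφ.aestronglyMeasurable hz hh,
    fun ⟨_, _, h⟩ => isZonal_of_involution_lift_ae_eq hφ.aestronglyMeasurable h⟩

end Descent

end ZonalFourier

/-! ### The equivalences -/

open ZonalFourier in
/-- `IsTopologicalGroup G` is a consequence of `LieGroup`; it is listed because Mathlib does not
infer it by instance search. The family `π` picks one representative of each class in `Ĝ`. -/
theorem mainTheorem7
    {E : Type*} [NormedAddCommGroup E] [NormedSpace ℝ E] [FiniteDimensional ℝ E]
    {G : Type*} [Group G] [TopologicalSpace G] [ChartedSpace E G] [LieGroup 𝓘(ℝ, E) ∞ G]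
    [IsTopologicalGroup G] [T2Space G] [CompactSpace G] [MeasurableSpace G] [BorelSpace G]
    {X : Type*} [TopologicalSpace X] [T2Space X] [MulAction G X] [ContinuousSMul G X]
    [MulAction.IsPretransitive G X] [MeasurableSpace X] [BorelSpace X]
    (x₀ : X) (π : Dual G → IrrUnitaryRep G) (hπ : ∀ c, (π c).toDual = c)
    (φ : X → ℂ) (hφ : MemLp φ 1 (homMeasure G x₀)) :
    (IsZonal G x₀ φ ↔
      ∀ c : Dual G, stabCoeff x₀ (π c) * groupFourierCoeff (lift G x₀ φ) (π c)
        = groupFourierCoeff (lift G x₀ φ) (π c) * stabCoeff x₀ (π c)) ∧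
    (IsZonal G x₀ φ ↔
      ∃ ψ : X → ℂ, MemLp ψ 1 (homMeasure G x₀) ∧
        involution (lift G x₀ φ) =ᵐ[normHaar G] lift G x₀ ψ) ∧
    (MemLp φ 2 (homMeasure G x₀) →
      (IsZonal G x₀ φ ↔
        ∃ ψ : X → ℂ, MemLp ψ 2 (homMeasure G x₀) ∧
          involution (lift G x₀ φ) =ᵐ[normHaar G] lift G x₀ ψ)) := by
  have : SecondCountableTopology G := ChartedSpace.secondCountable_of_sigmaCompact E G
  refine ⟨?_, isZonal_iff_exists_involution x₀ hφ, fun hφ₂ =>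
    isZonal_iff_exists_involution x₀ hφ₂⟩
  have hF : Integrable (lift G x₀ φ) (normHaar G) := memLp_one_iff_integrable.1 (memLp_lift hφ)
  -- This holds without zonality, since every lift is right H-invariant; commutation thus reduces to
  -- `φ̂ Ĥ = φ̂`.
  have hleft : ∀ c, stabCoeff x₀ (π c) * groupFourierCoeff (lift G x₀ φ) (π c) =
      groupFourierCoeff (lift G x₀ φ) (π c) := fun c =>
    stabCoeff_mul_of_invariant fun h hh => by
      rw [← groupFourierCoeff_comp_mul_right hF]
      simp only [lift_mul_of_mem_stabilizer x₀ φ _ hh]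
  rw [isZonal_iff_lift hφ.aestronglyMeasurable]
  constructor
  · intro hz c
    rw [hleft, mul_stabCoeff_of_invariant fun h hh => ?_]
    rw [← groupFourierCoeff_comp_mul_left hF]
    exact groupFourierCoeff_congr (hz h hh) _
  · intro hc h hh
    have hFh : Integrable (fun g => lift G x₀ φ (h * g)) (normHaar G) := hF.comp_mul_left h
    have hzero := ae_eq_zero_of_groupFourierCoeff_eq_zero (E := E) π hπ (hFh.sub hF) fun c => by
      have hright : groupFourierCoeff (lift G x₀ φ) (π c) * stabCoeff x₀ (π c) =
          groupFourierCoeff (lift G x₀ φ) (π c) := (hc c).symm.trans (hleft c)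
      change groupFourierCoeff ((fun g => lift G x₀ φ (h * g)) - lift G x₀ φ) (π c) = 0
      -- The difference has coefficient `φ̂ π(h) − φ̂ = φ̂ Ĥ π(h) − φ̂ Ĥ`, and `Ĥ` absorbs `π(h)`.
      rw [groupFourierCoeff_sub hFh hF, groupFourierCoeff_comp_mul_left hF, ← hright,
        Matrix.mul_assoc, stabCoeff_mul_mat x₀ _ hh, sub_self]
    filter_upwards [hzero] with g hg
    exact sub_eq_zero.1 hg
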